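/- Let $p$ be a prime number and let $K$ be a field containing $\mu_p$ (all $p$-th roots of unity of an algebraic closure of $K$). Let $G_K(p)$ be the maximal pro-$p$ quotient of the absolute Galois group of $K$, and assume that $G_K(p)$ is a free pro-$p$ group of arbitrary (possibly infinite) rank, i.e. free pro-$p$ on some set of generators converging to $1$. Then $K$ has asymptotically universally Koszul cohomology at $p$: the graded $\mathbb F_p$-algebra $H^\bullet(G_K(p),\mathbb F_p)=\bigoplus_{n\ge 0}H^n(G_K(p),\mathbb F_p)$ of continuous cohomology with trivial coefficients, with the cup product, is asymptotically universally Koszul. Here the following definitions are used, for a field $k$. A connected graded $k$-algebra $A=\bigoplus_{n\ge 0}A_n$ (so $A_0=k$) generated in degree $1$ is *quadratic* if $A\cong T(V)/\langle R\rangle$ with $V=A_1$ and a subspace $R\subseteq V\otimes_k V$. For a quadratic algebra $A$ with $\dim_k A_1<\infty$, let $\mathcal L(A)$ be the set of graded left ideals $I$ of $A$ with $I=A\,I_1$, where $I_1=I\cap A_1$. Such an $A$ is *universally Koszul* if for every $I\in\mathcal L(A)$ and every $x\in A_1\setminus I_1$ the left colon ideal $I:x=\{a\in A\mid ax\in I\}$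 belongs to $\mathcal L(A)$. A graded $k$-algebra $A$ is *asymptotically universally Koszul* if it is connected and generated in degree $1$, and there is a filtered system $(A_i)_{i\in I}$ of quadratic graded subalgebras of $A$ (with the inclusions as transition maps) such that: (i) each $A_i$ is generated in degree $1$ with $\dim_k (A_i)_1<\infty$; (ii) each $A_i$ is universally Koszul; (iii) the natural map $\varinjlim_{i\in I}A_i\to A$ is an isomorphism of graded algebras; (iv) every finite-dimensional subspace of $A_1$ is contained in some $(A_i)_1$. -/

import Mathlib

open scoped TensorProduct Topology

universe u v

/-! ### Quadratic, universally Koszul and asymptotically universally Koszul graded algebras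

Throughout, a grading on a `k`-algebra `A` is a family `𝒜 : ℕ → Submodule k A`. -/

section Koszul

variable {k : Type*} [Field k]

/-- `A = ⨁ₙ 𝒜 n` is a connected graded `k`-algebra (`𝒜 0 = k`), generated in degree `1`. -/
structure IsConnectedGenDegOne {A : Type*} [Ring A] [Algebra k A]
    (𝒜 : ℕ → Submodule k A) : Prop where
  /-- `1 ∈ 𝒜 0` and `𝒜 i * 𝒜 j ⊆ 𝒜 (i + j)`. -/
  gradedMonoid : SetLike.GradedMonoid 𝒜
  /-- `A` is the internal direct sum of the `𝒜 n`. -/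
  isInternal : DirectSum.IsInternal 𝒜
  /-- The structure map `k → 𝒜 0` is injective ... -/
  injective_algebraMap : Function.Injective (algebraMap k A)
  /-- ... and surjective. -/
  degree_zero : 𝒜 0 = LinearMap.range (Algebra.linearMap k A)
  generated : Algebra.adjoin k (𝒜 1 : Set A) = ⊤

/-- The inclusion `V ⊗ V → T(V)` of the degree `2` part of the tensor algebra. -/
noncomputable def tensorSquareToTensorAlgebra (k : Type*) [Field k] (V : Type*)
    [AddCommGroup V] [Module k V] : V ⊗[k] V →ₗ[k] TensorAlgebra k V :=
  LinearMap.mul' k (TensorAlgebra k V) ∘ₗ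
    TensorProduct.map (TensorAlgebra.ι k) (TensorAlgebra.ι k)

/-- A connected graded algebra generated in degree `1` is quadratic if, with `V = 𝒜 1`, it is
`T(V) / ⟨R⟩` for some subspace `R ⊆ V ⊗ V`: the canonical map `T(V) → A` (which is surjective)
has as kernel the two-sided ideal generated by `R`. -/
structure IsQuadraticAlgebra {A : Type*} [Ring A] [Algebra k A]
    (𝒜 : ℕ → Submodule k A) : Prop extends IsConnectedGenDegOne 𝒜 where
  surjective_lift : Function.Surjective (TensorAlgebra.lift k (𝒜 1).subtype)
  exists_relations : ∃ R : Submodule k (𝒜 1 ⊗[k] 𝒜 1),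
    TwoSidedIdeal.ker (TensorAlgebra.lift k (𝒜 1).subtype) =
      TwoSidedIdeal.span (tensorSquareToTensorAlgebra k (𝒜 1) '' R)

/-- The set `ℒ(A)`: the left ideal `I` is graded (`I = ⨁ₙ I ∩ 𝒜 n`), and it is generated by its
degree `1` part `I₁ = I ∩ 𝒜 1`. (`Ideal A` is the type of left ideals.) -/
def IsLeftIdealGenDegOne {A : Type*} [Ring A] [Algebra k A]
    (𝒜 : ℕ → Submodule k A) (I : Ideal A) : Prop :=
  I.restrictScalars k = ⨆ n, I.restrictScalars k ⊓ 𝒜 n ∧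
    I = Ideal.span ((I : Set A) ∩ (𝒜 1 : Set A))

/-- The left colon ideal `I : x = {a | a * x ∈ I}`. -/
def leftColon {A : Type*} [Ring A] (I : Ideal A) (x : A) : Ideal A :=
  Submodule.comap (LinearMap.toSpanSingleton A A x) I

theorem mem_leftColon {A : Type*} [Ring A] (I : Ideal A) (x a : A) :
    a ∈ leftColon I x ↔ a * x ∈ I := Iff.rfl

/-- A quadratic algebra with finite-dimensional degree `1` part is universally Koszul if
`I : x ∈ ℒ(A)` for all `I ∈ ℒ(A)` and all `x ∈ A₁ \ I₁`. -/
structure IsUniversallyKoszul {A : Type*} [Ring A] [Algebra k A]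
    (𝒜 : ℕ → Submodule k A) : Prop extends IsQuadraticAlgebra 𝒜 where
  finiteDimensional : FiniteDimensional k (𝒜 1)
  colon : ∀ I : Ideal A, IsLeftIdealGenDegOne 𝒜 I → ∀ x ∈ 𝒜 1, x ∉ I →
    IsLeftIdealGenDegOne 𝒜 (leftColon I x)

/-- A subalgebra is graded if it is the sum of its homogeneous parts. -/
def IsGradedSubalgebra {A : Type*} [Ring A] [Algebra k A]
    (𝒜 : ℕ → Submodule k A) (S : Subalgebra k A) : Prop :=
  Subalgebra.toSubmodule S = ⨆ n, Subalgebra.toSubmodule S ⊓ 𝒜 n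

/-- The grading `n ↦ S ∩ 𝒜 n` induced on a subalgebra `S`. -/
def inducedGrading {A : Type*} [Ring A] [Algebra k A]
    (𝒜 : ℕ → Submodule k A) (S : Subalgebra k A) (n : ℕ) : Submodule k S :=
  (𝒜 n).comap S.val.toLinearMap

/-- The canonical map `colim Sᵢ → A` for a family of subalgebras indexed by a preorder and
increasing with the index; the transition maps are the inclusions. -/
noncomputable def directLimitToAlgebra {A : Type*} [Ring A] [Algebra k A] {ι : Type*}
    [Preorder ι] [DecidableEq ι] (S : ι → Subalgebra k A) (hS : Monotone S) :
    Module.DirectLimit (fun i => S i)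
      (fun _ _ h => (Subalgebra.inclusion (hS h)).toLinearMap) →ₗ[k] A :=
  Module.DirectLimit.lift k ι (fun i => S i)
    (fun _ _ h => (Subalgebra.inclusion (hS h)).toLinearMap)
    (fun i => (S i).val.toLinearMap) (fun _ _ _ _ => rfl)

open Classical in
/-- A connected graded algebra generated in degree `1` is asymptotically universally Koszul if
there is a filtered system of quadratic graded subalgebras `Sᵢ`, each generated in degree `1` with
finite-dimensional degree `1` part and universally Koszul (all this is part of
`IsUniversallyKoszul`), such that `colim Sᵢ → A` is an isomorphism and every finite-dimensional
subspace of `𝒜 1` is contained in some `Sᵢ`. -/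
def IsAsymptoticallyUniversallyKoszul {A : Type v} [Ring A] [Algebra k A]
    (𝒜 : ℕ → Submodule k A) : Prop :=
  IsConnectedGenDegOne 𝒜 ∧
  ∃ (ι : Type v) (_ : Preorder ι) (_ : IsDirectedOrder ι) (_ : Nonempty ι)
    (S : ι → Subalgebra k A) (hS : Monotone S),
    (∀ i, IsGradedSubalgebra 𝒜 (S i)) ∧
    (∀ i, IsUniversallyKoszul (inducedGrading 𝒜 (S i))) ∧
    Function.Bijective (directLimitToAlgebra S hS) ∧
    ∀ W : Submodule k A, W ≤ 𝒜 1 → FiniteDimensional k W →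
      ∃ i, W ≤ Subalgebra.toSubmodule (S i) ⊓ 𝒜 1

end Koszul

/-! ### The continuous cohomology algebra with trivial coefficients

Inhomogeneous continuous cochains with values in a topological commutative ring `k` on which the
topological group `G` acts trivially, with the cup product. -/

namespace ContCoh

set_option linter.unusedSectionVars false

variable (k : Type v) [CommRing k] [TopologicalSpace k] [IsTopologicalRing k]
  (G : Type u) [Group G] [TopologicalSpace G] [IsTopologicalGroup G]

/-- Continuous inhomogeneous `n`-cochains. -/
abbrev Cochain (n : ℕ) : Type (max u v) := C(Fin n → G, k)

variable {G} in
theorem continuous_contractNth {n : ℕ} (j : Fin (n + 1)) :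
    Continuous fun x : Fin (n + 1) → G => Fin.contractNth j (· * ·) x := by
  refine continuous_pi fun i => ?_
  unfold Fin.contractNth
  split_ifs <;> fun_prop

/-- The differential
`(d f)(x₀, …, xₙ) = f(x₁, …, xₙ) + ∑ⱼ (-1)^(j+1) f(…, xⱼ xⱼ₊₁, …) + (-1)^(n+1) f(x₀, …, xₙ₋₁)`;
the last term is the one with `j = n` of the sum below, in which `Fin.contractNth` drops `xₙ`. -/
def d (n : ℕ) : Cochain k G n →ₗ[k] Cochain k G (n + 1) where
  toFun f :=
    { toFun := fun x => f (fun i => x i.succ) +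
        ∑ j : Fin (n + 1), (-1) ^ ((j : ℕ) + 1) * f (Fin.contractNth j (· * ·) x)
      continuous_toFun := by
        have := fun j : Fin (n + 1) => continuous_contractNth (G := G) j
        fun_prop }
  map_add' f g := by
    ext x
    simp [mul_add, Finset.sum_add_distrib, add_add_add_comm]
  map_smul' r f := by
    ext x
    simp [Finset.mul_sum, mul_add, mul_left_comm]

variable {k G}

theorem d_apply {n : ℕ} (f : Cochain k G n) (x : Fin (n + 1) → G) :
    d k G n f x = f (fun i => x i.succ) +
        ∑ j : Fin (n + 1), (-1) ^ ((j : ℕ) + 1) * f (Fin.contractNth j (· * ·) x) := rfl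

/-- The cup product `(f ∪ g)(x₁, …, xₘ₊ₙ) = f(x₁, …, xₘ) g(xₘ₊₁, …, xₘ₊ₙ)`. -/
def cup {m n : ℕ} (f : Cochain k G m) (g : Cochain k G n) : Cochain k G (m + n) where
  toFun x := f (fun i => x (Fin.castAdd n i)) * g (fun i => x (Fin.natAdd m i))

theorem cup_apply {m n : ℕ} (f : Cochain k G m) (g : Cochain k G n) (x : Fin (m + n) → G) :
    cup f g x = f (fun i => x (Fin.castAdd n i)) * g (fun i => x (Fin.natAdd m i)) := rfl

/-- Transport of a cochain along an equality of degrees. -/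
def castC {m n : ℕ} (h : m = n) (f : Cochain k G m) : Cochain k G n where
  toFun x := f (fun i => x (Fin.cast h i))

theorem castC_rfl {m : ℕ} (f : Cochain k G m) : castC rfl f = f := rfl

theorem leibniz {m n : ℕ} (a : Cochain k G m) (b : Cochain k G n) :
    d k G (m + n) (cup a b) =
      castC (by omega) (cup (d k G m a) b) + (-1 : k) ^ m • cup a (d k G n b) := by
  ext x
  have hx : ∀ {i j : Fin (m + n + 1)}, (i : ℕ) = j → x i = x j :=
    fun h => congrArg x (Fin.ext h)
  have hL : ∀ j : Fin m,
      cup a b (Fin.contractNth (Fin.castAdd (n + 1) j : Fin (m + (n + 1))) (· * ·) x) =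
      a (Fin.contractNth j.castSucc (· * ·)
        (fun i : Fin (m + 1) => x ⟨i, by omega⟩)) *
      b (fun i => x ⟨m + 1 + i, by omega⟩) := by
    intro j
    rw [cup_apply]
    refine congrArg₂ (· * ·) (congrArg a (funext fun i => ?_)) (congrArg b (funext fun i => ?_))
    · rfl
    · simp only [Fin.contractNth, Fin.val_castAdd, Fin.val_natAdd]
      rw [if_neg (by omega), if_neg (by omega)]
      exact hx (by simp; omega)
  have hR : ∀ j : Fin (n + 1),
      cup a b (Fin.contractNth (Fin.natAdd m j : Fin (m + (n + 1))) (· * ·) x) =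
      a (fun i => x ⟨i, by omega⟩) *
      b (Fin.contractNth j (· * ·) (fun i : Fin (n + 1) => x ⟨m + i, by omega⟩)) := by
    intro j
    rw [cup_apply]
    refine congrArg₂ (· * ·) (congrArg a (funext fun i => ?_)) (congrArg b (funext fun i => ?_))
    · simp only [Fin.contractNth, Fin.val_castAdd, Fin.val_natAdd]
      rw [if_pos (by omega)]
      rfl
    · simp only [Fin.contractNth, Fin.val_natAdd]
      split_ifs <;> first | omega | rfl
  have h0 : cup a b (fun i => x i.succ) =
      a (fun i => x ⟨i + 1, by omega⟩) * b (fun i => x ⟨m + 1 + i, by omega⟩) := by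
    rw [cup_apply]
    congr 2
    funext i
    exact hx (by simp; omega)
  have hA : castC (k := k) (G := G) (show m + 1 + n = m + n + 1 by omega)
      (cup (d k G m a) b) x =
      d k G m a (fun i => x ⟨i, by omega⟩) * b (fun i => x ⟨m + 1 + i, by omega⟩) := rfl
  have hB : cup a (d k G n b) x =
      a (fun i => x ⟨i, by omega⟩) * d k G n b (fun i => x ⟨m + i, by omega⟩) := rfl
  have hlast : Fin.contractNth (Fin.last m) (· * ·) (fun i : Fin (m + 1) => x ⟨i, by omega⟩) =
      fun i : Fin m => x ⟨i, by omega⟩ := by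
    funext i
    simp only [Fin.contractNth, Fin.val_last]
    rw [if_pos i.2]
    rfl
  have e1 : (fun i : Fin n => x ⟨m + (i + 1), by omega⟩) =
      fun i : Fin n => x ⟨m + 1 + i, by omega⟩ := by
    funext i
    exact hx (by simp; omega)
  have hda : d k G m a (fun i => x ⟨i, by omega⟩) = a (fun i => x ⟨i + 1, by omega⟩) +
      (∑ j : Fin m, (-1) ^ ((j : ℕ) + 1) * a (Fin.contractNth j.castSucc (· * ·)
        (fun i : Fin (m + 1) => x ⟨i, by omega⟩)) +
      (-1) ^ (m + 1) * a (fun i => x ⟨i, by omega⟩)) := by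
    rw [d_apply, Fin.sum_univ_castSucc, hlast]
    rfl
  have hdb : d k G n b (fun i => x ⟨m + i, by omega⟩) = b (fun i : Fin n => x ⟨m + 1 + i, by omega⟩) +
      ∑ j : Fin (n + 1), (-1) ^ ((j : ℕ) + 1) * b (Fin.contractNth j (· * ·)
        (fun i : Fin (n + 1) => x ⟨m + i, by omega⟩)) := by
    rw [d_apply, ← e1]
    rfl
  have hdab : d k G (m + n) (cup a b) x =
      a (fun i => x ⟨i + 1, by omega⟩) * b (fun i => x ⟨m + 1 + i, by omega⟩) +
      (∑ j : Fin m, (-1) ^ ((j : ℕ) + 1) * (a (Fin.contractNth j.castSucc (· * ·)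
          (fun i : Fin (m + 1) => x ⟨i, by omega⟩)) * b (fun i => x ⟨m + 1 + i, by omega⟩)) +
       ∑ j : Fin (n + 1), (-1) ^ (m + (j : ℕ) + 1) * (a (fun i => x ⟨i, by omega⟩) *
          b (Fin.contractNth j (· * ·) (fun i : Fin (n + 1) => x ⟨m + i, by omega⟩)))) := by
    rw [d_apply, h0]
    congr 1
    refine (Fin.sum_univ_add (a := m) (b := n + 1) fun j => (-1 : k) ^ ((j : ℕ) + 1) *
      cup a b (Fin.contractNth (j : Fin (m + n + 1)) (· * ·) x)).trans ?_
    congr 1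
    · exact Finset.sum_congr rfl fun j _ => congrArg _ (hL j)
    · exact Finset.sum_congr rfl fun j _ => congrArg _ (hR j)
  rw [ContinuousMap.add_apply, ContinuousMap.smul_apply, hA, hB, hda, hdb, hdab, smul_eq_mul,
    add_mul, add_mul, Finset.sum_mul, mul_add, mul_add, Finset.mul_sum, Finset.mul_sum]
  have s1 : ∀ j : Fin (n + 1), ∀ s t : k, (-1 : k) ^ (m + (j : ℕ) + 1) * (s * t) =
      (-1) ^ m * (s * ((-1) ^ ((j : ℕ) + 1) * t)) := fun j s t => by ring
  simp only [s1, mul_assoc, pow_succ (-1 : k) m]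
  ring

variable (k G)

/-- Continuous cocycles. -/
def cocycles (n : ℕ) : Submodule k (Cochain k G n) := LinearMap.ker (d k G n)

/-- Continuous coboundaries. -/
def coboundaries : (n : ℕ) → Submodule k (Cochain k G n)
  | 0 => ⊥
  | n + 1 => LinearMap.range (d k G n)

/-- Continuous cohomology `Hⁿ(G, k)` with trivial coefficients. -/
def H (n : ℕ) : Type (max u v) :=
  cocycles k G n ⧸ (coboundaries k G n).comap (cocycles k G n).subtype

instance instAddCommGroupH (n : ℕ) : AddCommGroup (H k G n) :=
  Submodule.Quotient.addCommGroup ((coboundaries k G n).comap (cocycles k G n).subtype)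

instance instModuleH (n : ℕ) : Module k (H k G n) :=
  Submodule.Quotient.module ((coboundaries k G n).comap (cocycles k G n).subtype)

variable {k G}

theorem castC_mem_coboundaries {m n : ℕ} (h : m = n) {f : Cochain k G m} :
    castC h f ∈ coboundaries k G n ↔ f ∈ coboundaries k G m := by
  subst h
  rfl

theorem castC_castC {m n : ℕ} (h : m = n) (f : Cochain k G m) :
    castC h.symm (castC h f) = f := rfl

theorem castC_add {m n : ℕ} (h : m = n) (f g : Cochain k G m) :
    castC h (f + g) = castC h f + castC h g := rfl

theorem castC_zero {m n : ℕ} (h : m = n) : castC h (0 : Cochain k G m) = 0 := rfl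

theorem cup_zero {m n : ℕ} (f : Cochain k G m) : cup f (0 : Cochain k G n) = 0 := by
  ext x
  simp [cup_apply]

theorem zero_cup {m n : ℕ} (g : Cochain k G n) : cup (0 : Cochain k G m) g = 0 := by
  ext x
  simp [cup_apply]

theorem cup_mem_cocycles {m n : ℕ} {f : Cochain k G m} {g : Cochain k G n}
    (hf : f ∈ cocycles k G m) (hg : g ∈ cocycles k G n) : cup f g ∈ cocycles k G (m + n) := by
  have hf' : d k G m f = 0 := hf
  have hg' : d k G n g = 0 := hg
  change d k G (m + n) (cup f g) = 0
  rw [leibniz, hf', hg', zero_cup, cup_zero, castC_zero, smul_zero, add_zero]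

theorem cup_mem_coboundaries_right {m n : ℕ} {f : Cochain k G m} {g : Cochain k G n}
    (hf : f ∈ cocycles k G m) (hg : g ∈ coboundaries k G n) :
    cup f g ∈ coboundaries k G (m + n) := by
  cases n with
  | zero =>
    have : g = 0 := hg
    rw [this, cup_zero]
    exact zero_mem _
  | succ n =>
    obtain ⟨b, rfl⟩ := hg
    have hf' : d k G m f = 0 := hf
    refine ⟨(-1 : k) ^ m • cup f b, ?_⟩
    have h := leibniz f b
    rw [hf', zero_cup, castC_zero, zero_add] at h
    have h' : d k G (m + n) ((-1 : k) ^ m • cup f b) = cup f (d k G n b) := by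
      rw [map_smul, h, smul_smul, ← mul_pow]
      simp
    exact h'

theorem cup_mem_coboundaries_left {m n : ℕ} {f : Cochain k G m} {g : Cochain k G n}
    (hf : f ∈ coboundaries k G m) (hg : g ∈ cocycles k G n) :
    cup f g ∈ coboundaries k G (m + n) := by
  cases m with
  | zero =>
    have : f = 0 := hf
    rw [this, zero_cup]
    exact zero_mem _
  | succ m =>
    obtain ⟨a, rfl⟩ := hf
    have hg' : d k G n g = 0 := hg
    rw [← castC_mem_coboundaries (show m + 1 + n = m + n + 1 by omega)]
    refine ⟨cup a g, ?_⟩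
    rw [leibniz, hg', cup_zero, smul_zero, add_zero]

/-- The cup product of cocycles. -/
def cupZ (m n : ℕ) : cocycles k G m →ₗ[k] cocycles k G n →ₗ[k] cocycles k G (m + n) :=
  LinearMap.mk₂ k (fun f g => ⟨cup f.1 g.1, cup_mem_cocycles f.2 g.2⟩)
    (fun f f' g => by ext x; simp [cup_apply, add_mul])
    (fun r f g => by ext x; simp [cup_apply, mul_assoc])
    (fun f g g' => by ext x; simp [cup_apply, mul_add])
    (fun r f g => by ext x; simp [cup_apply, mul_left_comm])

/-- The projection sending a cocycle to its cohomology class. -/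
def mk {n : ℕ} : cocycles k G n →ₗ[k] H k G n :=
  Submodule.mkQ ((coboundaries k G n).comap (cocycles k G n).subtype)

theorem mk_eq_zero {n : ℕ} {z : cocycles k G n} : mk z = 0 ↔ z.1 ∈ coboundaries k G n :=
  Submodule.Quotient.mk_eq_zero ((coboundaries k G n).comap (cocycles k G n).subtype)

theorem exists_mk {n : ℕ} (a : H k G n) : ∃ z, mk z = a :=
  Submodule.mkQ_surjective ((coboundaries k G n).comap (cocycles k G n).subtype) a

/-- The linear map on cohomology induced by a linear map on cocycles that kills coboundaries. -/
def liftH {M : Type*} [AddCommGroup M] [Module k M] {n : ℕ} (φ : cocycles k G n →ₗ[k] M)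
    (hφ : ∀ z, z.1 ∈ coboundaries k G n → φ z = 0) : H k G n →ₗ[k] M :=
  Submodule.liftQ ((coboundaries k G n).comap (cocycles k G n).subtype) φ hφ

theorem liftH_mk {M : Type*} [AddCommGroup M] [Module k M] {n : ℕ} (φ : cocycles k G n →ₗ[k] M)
    (hφ : ∀ z, z.1 ∈ coboundaries k G n → φ z = 0) (z : cocycles k G n) :
    liftH φ hφ (mk z) = φ z := rfl

/-- The cup product on cohomology, induced by the cup product of cocycles. -/
def cupH (m n : ℕ) : H k G m →ₗ[k] H k G n →ₗ[k] H k G (m + n) :=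
  liftH
    { toFun := fun f => liftH (mk ∘ₗ cupZ m n f)
        (fun g hg => mk_eq_zero.2 (cup_mem_coboundaries_right f.2 hg))
      map_add' := fun f f' => by
        refine LinearMap.ext fun g => ?_
        obtain ⟨g, rfl⟩ := exists_mk g
        simp [liftH_mk]
      map_smul' := fun r f => by
        refine LinearMap.ext fun g => ?_
        obtain ⟨g, rfl⟩ := exists_mk g
        simp [liftH_mk] }
    (fun f hf => by
      refine LinearMap.ext fun g => ?_
      obtain ⟨g, rfl⟩ := exists_mk g
      exact mk_eq_zero.2 (cup_mem_coboundaries_left hf g.2))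

theorem cupH_mk {m n : ℕ} (f : cocycles k G m) (g : cocycles k G n) :
    cupH m n (mk f) (mk g) = mk (cupZ m n f g) := rfl

/-- The constant `0`-cochains are cocycles. -/
def constZ (r : k) : cocycles k G 0 :=
  ⟨ContinuousMap.const _ r, by
    refine LinearMap.mem_ker.2 ?_
    ext x
    simp [d_apply]⟩

theorem gradedMk_eq {m n : ℕ} (h : m = n) (z : cocycles k G m) (w : cocycles k G n)
    (hzw : castC h z.1 = w.1) :
    GradedMonoid.mk (A := H k G) m (mk z) = GradedMonoid.mk n (mk w) := by
  subst h
  have : z = w := Subtype.ext hzw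
  rw [this]

noncomputable instance instGMul : GradedMonoid.GMul (H k G) where
  mul a b := cupH _ _ a b

noncomputable instance instGOne : GradedMonoid.GOne (H k G) where
  one := mk (constZ 1)

theorem gmul_mk {m n : ℕ} (f : cocycles k G m) (g : cocycles k G n) :
    GradedMonoid.mk (A := H k G) m (mk f) * GradedMonoid.mk n (mk g) =
      GradedMonoid.mk (m + n) (mk (cupZ m n f g)) := rfl

theorem const_gmul {n : ℕ} (r : k) (z : cocycles k G n) :
    GradedMonoid.mk (A := H k G) 0 (mk (constZ r)) * GradedMonoid.mk n (mk z) =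
      GradedMonoid.mk n (mk (r • z)) := by
  rw [gmul_mk]
  refine gradedMk_eq (zero_add n) _ _ ?_
  ext x
  change r * z.1 _ = r * z.1 x
  congr 2
  funext i
  exact congrArg x (Fin.ext (by simp))

theorem gmul_const {n : ℕ} (r : k) (z : cocycles k G n) :
    GradedMonoid.mk (A := H k G) n (mk z) * GradedMonoid.mk 0 (mk (constZ r)) =
      GradedMonoid.mk n (mk (r • z)) := by
  rw [gmul_mk]
  refine gradedMk_eq (add_zero n) _ _ ?_
  ext x
  exact mul_comm _ _

theorem gmul_assoc' (a b c : GradedMonoid (H k G)) : a * b * c = a * (b * c) := by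
  obtain ⟨l, a⟩ := a
  obtain ⟨m, b⟩ := b
  obtain ⟨n, c⟩ := c
  obtain ⟨a, rfl⟩ := exists_mk a
  obtain ⟨b, rfl⟩ := exists_mk b
  obtain ⟨c, rfl⟩ := exists_mk c
  refine gradedMk_eq (add_assoc l m n) _ _ ?_
  ext x
  change a.1 _ * b.1 _ * c.1 _ = a.1 _ * (b.1 _ * c.1 _)
  rw [mul_assoc]
  refine congrArg₂ (· * ·) rfl (congrArg₂ (· * ·) rfl (congrArg c.1 (funext fun i => ?_)))
  exact congrArg x (Fin.ext (add_assoc l m i))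

/-- `H^•(G, k)` is a graded ring under the cup product. -/
noncomputable instance instGRing : DirectSum.GRing (H k G) where
  one_mul a := by
    obtain ⟨n, a⟩ := a
    obtain ⟨a, rfl⟩ := exists_mk a
    exact (const_gmul 1 a).trans (by rw [one_smul]; rfl)
  mul_one a := by
    obtain ⟨n, a⟩ := a
    obtain ⟨a, rfl⟩ := exists_mk a
    exact (gmul_const 1 a).trans (by rw [one_smul]; rfl)
  mul_assoc := gmul_assoc'
  mul_zero a := map_zero (cupH _ _ a)
  zero_mul b := LinearMap.map_zero₂ (cupH _ _) b
  mul_add a := map_add (cupH _ _ a)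
  add_mul a b c := LinearMap.map_add₂ (cupH _ _) a b c
  natCast n := n • mk (constZ 1)
  natCast_zero := zero_smul _ _
  natCast_succ n := succ_nsmul _ n
  intCast n := n • mk (constZ 1)
  intCast_ofNat n := natCast_zsmul _ n
  intCast_negSucc_ofNat n := negSucc_zsmul _ n

/-- `H^•(G, k)` is a graded `k`-algebra; the structure map sends `r` to the class of the constant
`0`-cocycle `r`. -/
noncomputable instance instGAlgebra : DirectSum.GAlgebra k (H k G) where
  toFun :=
    { toFun := fun r => mk (constZ r)
      map_zero' := rfl
      map_add' := fun _ _ => rfl }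
  map_one := rfl
  map_mul r s := (const_gmul r (constZ s)).symm
  commutes r x := by
    obtain ⟨n, x⟩ := x
    obtain ⟨x, rfl⟩ := exists_mk x
    exact (const_gmul r x).trans (gmul_const r x).symm
  smul_def r x := by
    obtain ⟨n, x⟩ := x
    obtain ⟨x, rfl⟩ := exists_mk x
    exact (const_gmul r x).symm

variable (k G)

/-- The continuous cohomology algebra `H^•(G, k) = ⨁ₙ Hⁿ(G, k)`. -/
abbrev Total : Type (max u v) := DirectSum ℕ (H k G)

/-- The grading of the continuous cohomology algebra. -/
noncomputable def grading (n : ℕ) : Submodule k (Total k G) :=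
  LinearMap.range (DirectSum.lof k ℕ (H k G) n)

end ContCoh

/-! ### Pro-`p` groups and the maximal pro-`p` Galois group -/

section ProP

/-- A topological group is pro-`p` if it is profinite and all its quotients by open normal
subgroups are finite `p`-groups. -/
structure IsProP (p : ℕ) (G : Type*) [Group G] [TopologicalSpace G] : Prop where
  isTopologicalGroup : IsTopologicalGroup G
  compactSpace : CompactSpace G
  t2Space : T2Space G
  totallyDisconnectedSpace : TotallyDisconnectedSpace G
  index_eq : ∀ N : Subgroup G, N.Normal → IsOpen (N : Set G) → ∃ n : ℕ, N.index = p ^ n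

/-- A family in a topological group converges to `1` if every neighbourhood of `1` contains all but
finitely many of its members. -/
def ConvergesToOne {X G : Type*} [Group G] [TopologicalSpace G] (f : X → G) : Prop :=
  Filter.Tendsto f Filter.cofinite (𝓝 1)

/-- `F` is a free pro-`p` group with basis `b : X → F`: it is pro-`p`, `b` converges to `1`, and
every map from `X` to a pro-`p` group that converges to `1` extends uniquely along `b` to a
continuous homomorphism. -/
structure IsFreeProPOn (p : ℕ) {X F : Type u} [Group F] [TopologicalSpace F] (b : X → F) :
    Prop where
  isProP : IsProP p F
  convergesToOne : ConvergesToOne b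
  existsUnique_lift : ∀ (P : Type u) [Group P] [TopologicalSpace P], IsProP p P →
    ∀ f : X → P, ConvergesToOne f → ∃! φ : F →ₜ* P, ∀ x, φ (b x) = f x

/-- `F` is a free pro-`p` group, of arbitrary rank. -/
def IsFreeProP (p : ℕ) (F : Type u) [Group F] [TopologicalSpace F] : Prop :=
  ∃ (X : Type u) (b : X → F), IsFreeProPOn p b

/-- The intersection of all open normal subgroups of `p`-power index: the kernel of the projection
of a profinite group to its maximal pro-`p` quotient. -/
def proPKernel (p : ℕ) (G : Type*) [Group G] [TopologicalSpace G] : Subgroup G :=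
  sInf {N : Subgroup G | N.Normal ∧ IsOpen (N : Set G) ∧ ∃ n : ℕ, N.index = p ^ n}

instance proPKernel_normal (p : ℕ) (G : Type*) [Group G] [TopologicalSpace G] :
    (proPKernel p G).Normal where
  conj_mem g hg x := by
    rw [proPKernel, Subgroup.mem_sInf] at hg ⊢
    exact fun N hN => hN.1.conj_mem g (hg N hN) x

/-- The maximal pro-`p` Galois group `G_K(p)`: the maximal pro-`p` quotient of the absolute Galois
group of `K`, with the quotient topology. -/
abbrev maximalProPGaloisGroup (p : ℕ) (K : Type u) [Field K] : Type u :=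
  Field.absoluteGaloisGroup K ⧸ proPKernel p (Field.absoluteGaloisGroup K)

/-- `K` contains the `p`-th roots of unity (of an algebraic closure of `K`). -/
def ContainsRootsOfUnity (p : ℕ) (K : Type u) [Field K] : Prop :=
  ∀ ζ : AlgebraicClosure K, ζ ^ p = 1 → ζ ∈ Set.range (algebraMap K (AlgebraicClosure K))

/-- `H^•(G_K(p), 𝔽_p)` is asymptotically universally Koszul. -/
def HasAsymptoticallyUniversallyKoszulCohomology (p : ℕ) [Fact p.Prime] (K : Type u) [Field K] :
    Prop :=
  IsAsymptoticallyUniversallyKoszul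
    (ContCoh.grading (ZMod p) (maximalProPGaloisGroup p K))

end ProP

/-! A free pro-`p` group `F` has cohomological dimension at most one, so its cohomology algebra is
`𝔽_p ⊕ H¹` with all products of degree one classes zero. Any such algebra `k ⊕ V` with `V V = 0` is
asymptotically universally Koszul. Its relations are all of `V ⊗ V`. If `x ∈ V` is not in the left
ideal `I`, then `(c + v) x = c x` lies in `I` only for `c = 0`, so `I : x = V`, which is generated
in degree one (`mem_leftColon_iff`). The subalgebras `k ⊕ W`, with `W ⊆ V` finite-dimensional, have
the same shape and form the required filtered system.

The vanishing of `Hⁿ` for `n ≥ 2` is proved on inhomogeneous cochains. Freeness enters through the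
equation `f (g x) - f g = h (g, x) - h (g, 1)` for `x` in the basis. A continuous solution exists
(`IsFreeProPOn.exists_primitive`), and the homogeneous equation has only constant solutions
(`IsFreeProPOn.eq_of_invariant`). These are the existence and uniqueness halves of the universal
property for maps into the finite `p`-groups `𝔽_p^Q ⋊ Q`, where `Q` is a finite quotient of `F`: the
first component of such a map is a crossed homomorphism, whose value at `1 ∈ Q` is `f`. Solving the
equation in the last two variables of a cocycle gives a primitive up to a term independent of the
last variable, which is an explicit coboundary (`ContCoh.cocycles_le_coboundaries`). -/

/-! ### Graded algebras concentrated in degrees zero and one -/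

section Truncated

variable {k : Type*} [Field k]

/-- A graded algebra `A = k ⊕ 𝒜 1` concentrated in degrees `0` and `1`. -/
structure IsConnectedTruncated {A : Type*} [Ring A] [Algebra k A] (𝒜 : ℕ → Submodule k A) :
    Prop where
  gradedMonoid : SetLike.GradedMonoid 𝒜
  injective_algebraMap : Function.Injective (algebraMap k A)
  degree_zero : 𝒜 0 = LinearMap.range (Algebra.linearMap k A)
  isCompl : IsCompl (𝒜 0) (𝒜 1)
  eq_bot : ∀ n, 𝒜 (n + 2) = ⊥

theorem isInternal_of_isCompl {A : Type*} [AddCommGroup A] [Module k A] {𝒜 : ℕ → Submodule k A}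
    (h : IsCompl (𝒜 0) (𝒜 1)) (hbot : ∀ n, 𝒜 (n + 2) = ⊥) : DirectSum.IsInternal 𝒜 := by
  rw [DirectSum.isInternal_submodule_iff_iSupIndep_and_iSup_eq_top]
  refine ⟨fun i => ?_, ?_⟩
  · match i with
    | 0 =>
      refine h.disjoint.mono_right (iSup₂_le fun j hj => ?_)
      match j with
      | 0 => exact absurd rfl hj
      | 1 => exact le_rfl
      | n + 2 => exact (hbot n).le.trans bot_le
    | 1 =>
      refine h.disjoint.symm.mono_right (iSup₂_le fun j hj => ?_)
      match j with
      | 0 => exact le_rfl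
      | 1 => exact absurd rfl hj
      | n + 2 => exact (hbot n).le.trans bot_le
    | n + 2 =>
      rw [hbot]
      exact disjoint_bot_left
  · rw [eq_top_iff, ← h.sup_eq_top]
    exact sup_le (le_iSup 𝒜 0) (le_iSup 𝒜 1)

namespace IsConnectedTruncated

variable {A : Type*} [Ring A] [Algebra k A] {𝒜 : ℕ → Submodule k A}

theorem mul_eq_zero (h : IsConnectedTruncated 𝒜) {v w : A} (hv : v ∈ 𝒜 1) (hw : w ∈ 𝒜 1) :
    v * w = 0 := by
  have := h.gradedMonoid.mul_mem hv hw
  rwa [h.eq_bot 0, Submodule.mem_bot] at this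

theorem exists_eq_add (h : IsConnectedTruncated 𝒜) (a : A) :
    ∃ c : k, ∃ v ∈ 𝒜 1, a = algebraMap k A c + v := by
  have ha : a ∈ 𝒜 0 ⊔ 𝒜 1 := by
    rw [h.isCompl.sup_eq_top]
    trivial
  obtain ⟨y, hy, v, hv, rfl⟩ := Submodule.mem_sup.1 ha
  rw [h.degree_zero] at hy
  obtain ⟨c, rfl⟩ := hy
  exact ⟨c, v, hv, rfl⟩

theorem eq_zero_of_algebraMap_mem (h : IsConnectedTruncated 𝒜) {c : k}
    (hc : algebraMap k A c ∈ 𝒜 1) : c = 0 := by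
  have h0 : algebraMap k A c ∈ 𝒜 0 := by
    rw [h.degree_zero]
    exact ⟨c, rfl⟩
  have := Submodule.disjoint_def.1 h.isCompl.disjoint _ h0 hc
  exact h.injective_algebraMap (this.trans (map_zero _).symm)

theorem isConnectedGenDegOne (h : IsConnectedTruncated 𝒜) : IsConnectedGenDegOne 𝒜 where
  gradedMonoid := h.gradedMonoid
  isInternal := isInternal_of_isCompl h.isCompl h.eq_bot
  injective_algebraMap := h.injective_algebraMap
  degree_zero := h.degree_zero
  generated := by
    refine eq_top_iff.2 fun a _ => ?_
    obtain ⟨c, v, hv, rfl⟩ := h.exists_eq_add a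
    exact add_mem (Subalgebra.algebraMap_mem _ c) (Algebra.subset_adjoin hv)

/-- Modulo the ideal generated by `V ⊗ V` only the constant and linear parts of a tensor survive:
`(c + v)(c' + v') = c c' + (c v' + c' v) + v v'`, and `v v'` lies in the ideal. -/
theorem exists_sub_mem_span (V : Type*) [AddCommGroup V] [Module k V] (t : TensorAlgebra k V) :
    ∃ (c : k) (v : V), t - (algebraMap k _ c + TensorAlgebra.ι k v) ∈
      TwoSidedIdeal.span (tensorSquareToTensorAlgebra k V '' (⊤ : Submodule k (V ⊗[k] V))) := by
  set J := TwoSidedIdeal.span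
    (tensorSquareToTensorAlgebra k V '' ((⊤ : Submodule k (V ⊗[k] V)) : Set (V ⊗[k] V)))
  have hJ : ∀ v w : V, TensorAlgebra.ι k v * TensorAlgebra.ι k w ∈ J := fun v w =>
    TwoSidedIdeal.subset_span ⟨v ⊗ₜ w, trivial, by simp [tensorSquareToTensorAlgebra]⟩
  induction t using TensorAlgebra.induction with
  | algebraMap r => exact ⟨r, 0, by simp⟩
  | ι x => exact ⟨0, x, by simp⟩
  | add a b ha hb =>
    obtain ⟨c, v, h⟩ := ha
    obtain ⟨c', v', h'⟩ := hb
    refine ⟨c + c', v + v', ?_⟩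
    have := J.add_mem h h'
    rw [map_add, map_add]
    convert this using 1
    abel
  | mul a b ha hb =>
    obtain ⟨c, v, h⟩ := ha
    obtain ⟨c', v', h'⟩ := hb
    refine ⟨c * c', c • v' + c' • v, ?_⟩
    have h1 := J.mul_mem_right _ b h
    have h2 := J.mul_mem_left (algebraMap k _ c + TensorAlgebra.ι k v) _ h'
    -- With `l = c + v` and `l' = c' + v'`, this is `a b - l l' = (a - l) b + l (b - l')`, plus the
    -- quadratic term `v v'`.
    convert J.add_mem (J.add_mem h1 h2) (hJ v v') using 1
    simp only [map_add, map_smul, map_mul, Algebra.smul_def, sub_mul, mul_sub, add_mul, mul_add,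
      Algebra.commutes c' (TensorAlgebra.ι k v)]
    abel

/-- All of `V ⊗ V` serves as space of relations. A tensor in the kernel is congruent to some `c +
v`, which also maps to zero; as degrees zero and one meet trivially, `c = 0` and `v = 0`. -/
theorem isQuadraticAlgebra (h : IsConnectedTruncated 𝒜) : IsQuadraticAlgebra 𝒜 where
  toIsConnectedGenDegOne := h.isConnectedGenDegOne
  surjective_lift := fun a => by
    obtain ⟨c, v, hv, rfl⟩ := h.exists_eq_add a
    exact ⟨algebraMap k _ c + TensorAlgebra.ι k ⟨v, hv⟩, by simp⟩
  exists_relations := by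
    have hle : TwoSidedIdeal.span (tensorSquareToTensorAlgebra k (𝒜 1) ''
        ((⊤ : Submodule k (𝒜 1 ⊗[k] 𝒜 1)) : Set (𝒜 1 ⊗[k] 𝒜 1))) ≤
        TwoSidedIdeal.ker (TensorAlgebra.lift k (𝒜 1).subtype) := by
      refine TwoSidedIdeal.span_le.2 ?_
      rintro _ ⟨t, -, rfl⟩
      rw [SetLike.mem_coe, TwoSidedIdeal.mem_ker]
      induction t using TensorProduct.induction_on with
      | zero => simp
      | tmul v w => simpa [tensorSquareToTensorAlgebra] using h.mul_eq_zero v.2 w.2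
      | add a b ha hb => rw [map_add, map_add, ha, hb, add_zero]
    refine ⟨⊤, le_antisymm (fun t ht => ?_) hle⟩
    obtain ⟨c, v, hJ⟩ := exists_sub_mem_span (k := k) (𝒜 1) t
    have h1 := hle hJ
    rw [TwoSidedIdeal.mem_ker] at h1 ht
    rw [map_sub, ht, zero_sub, neg_eq_zero, map_add, AlgHom.commutes,
      TensorAlgebra.lift_ι_apply, Submodule.subtype_apply] at h1
    obtain rfl : c = 0 := h.eq_zero_of_algebraMap_mem (by
      rw [eq_neg_of_add_eq_zero_left h1]
      exact neg_mem v.2)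
    obtain rfl : v = 0 := by simpa using h1
    simpa using hJ

/-- Multiplication by `x` kills degree one, so only the constant term of `a` matters, and a nonzero
constant is invertible. The colon ideal is therefore the same for every `I` and `x`. -/
theorem mem_leftColon_iff (h : IsConnectedTruncated 𝒜) {I : Ideal A} {x : A} (hx : x ∈ 𝒜 1)
    (hxI : x ∉ I) (a : A) : a ∈ leftColon I x ↔ a ∈ 𝒜 1 := by
  rw [mem_leftColon]
  refine ⟨fun ha => ?_, fun ha => by rw [h.mul_eq_zero ha hx]; exact zero_mem _⟩
  obtain ⟨c, v, hv, rfl⟩ := h.exists_eq_add a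
  rw [add_mul, h.mul_eq_zero hv hx, add_zero] at ha
  have hc : c = 0 := by
    by_contra hc
    refine hxI ?_
    have := I.mul_mem_left (algebraMap k A c⁻¹) ha
    rwa [← mul_assoc, ← map_mul, inv_mul_cancel₀ hc, map_one, one_mul] at this
  rwa [hc, map_zero, zero_add]

theorem isUniversallyKoszul (h : IsConnectedTruncated 𝒜) (hfin : FiniteDimensional k (𝒜 1)) :
    IsUniversallyKoszul 𝒜 where
  toIsQuadraticAlgebra := h.isQuadraticAlgebra
  finiteDimensional := hfin
  colon I _ x hx hxI := by
    have hJ := h.mem_leftColon_iff hx hxI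
    refine ⟨le_antisymm (fun a ha => ?_) (iSup_le fun n => inf_le_left), le_antisymm (fun a ha => ?_)
      (Ideal.span_le.2 Set.inter_subset_left)⟩
    · exact Submodule.mem_iSup_of_mem 1 ⟨ha, (hJ a).1 ha⟩
    · exact Ideal.subset_span ⟨ha, (hJ a).1 ha⟩

/-- The subalgebra `k ⊕ W` for a subspace `W` of the degree `1` part. -/
def subalgebra (h : IsConnectedTruncated 𝒜) (W : Submodule k A) (hW : W ≤ 𝒜 1) :
    Subalgebra k A :=
  (𝒜 0 ⊔ W).toSubalgebra (Submodule.mem_sup_left h.gradedMonoid.one_mem) (by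
    intro a b ha hb
    rw [h.degree_zero] at ha hb ⊢
    obtain ⟨_, ⟨c, rfl⟩, v, hv, rfl⟩ := Submodule.mem_sup.1 ha
    obtain ⟨_, ⟨d, rfl⟩, w, hw, rfl⟩ := Submodule.mem_sup.1 hb
    refine Submodule.mem_sup.2 ⟨_, ⟨c * d, rfl⟩, c • w + d • v,
      add_mem (W.smul_mem _ hw) (W.smul_mem _ hv), ?_⟩
    simp only [Algebra.linearMap_apply, map_mul, Algebra.smul_def, add_mul, mul_add,
      h.mul_eq_zero (hW hv) (hW hw), Algebra.commutes d v]
    abel)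

theorem mem_subalgebra_iff (h : IsConnectedTruncated 𝒜) {W : Submodule k A} (hW : W ≤ 𝒜 1) {a : A} :
    a ∈ h.subalgebra W hW ↔ a ∈ 𝒜 0 ⊔ W := Iff.rfl

theorem toSubmodule_subalgebra (h : IsConnectedTruncated 𝒜) {W : Submodule k A} (hW : W ≤ 𝒜 1) :
    Subalgebra.toSubmodule (h.subalgebra W hW) = 𝒜 0 ⊔ W := rfl

theorem mem_of_mem_subalgebra (h : IsConnectedTruncated 𝒜) {W : Submodule k A} (hW : W ≤ 𝒜 1)
    {a : A} (ha : a ∈ h.subalgebra W hW) (ha1 : a ∈ 𝒜 1) : a ∈ W := by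
  obtain ⟨y, hy, w, hw, rfl⟩ := Submodule.mem_sup.1 ((h.mem_subalgebra_iff hW).1 ha)
  have hy1 : y ∈ 𝒜 1 := by simpa using sub_mem ha1 (hW hw)
  rwa [Submodule.disjoint_def.1 h.isCompl.disjoint y hy hy1, zero_add]

theorem isGradedSubalgebra (h : IsConnectedTruncated 𝒜) {W : Submodule k A} (hW : W ≤ 𝒜 1) :
    IsGradedSubalgebra 𝒜 (h.subalgebra W hW) := by
  refine le_antisymm ?_ (iSup_le fun n => inf_le_left)
  rw [h.toSubmodule_subalgebra]
  exact sup_le (le_iSup_of_le 0 (le_inf le_sup_left le_rfl))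
    (le_iSup_of_le 1 (le_inf le_sup_right hW))

theorem inducedGrading_subalgebra (h : IsConnectedTruncated 𝒜) {W : Submodule k A} (hW : W ≤ 𝒜 1) :
    IsConnectedTruncated (inducedGrading 𝒜 (h.subalgebra W hW)) where
  gradedMonoid :=
    { one_mem := h.gradedMonoid.one_mem
      mul_mem := fun _ _ _ _ ha hb => h.gradedMonoid.mul_mem ha hb }
  injective_algebraMap := fun c d hcd => h.injective_algebraMap (congrArg Subtype.val hcd)
  degree_zero := by
    ext a
    change (a : A) ∈ 𝒜 0 ↔ _
    rw [h.degree_zero]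
    exact ⟨fun ⟨c, hc⟩ => ⟨c, Subtype.ext hc⟩, fun ⟨c, hc⟩ => ⟨c, congrArg Subtype.val hc⟩⟩
  isCompl := by
    refine IsCompl.of_eq ?_ ?_
    · refine eq_bot_iff.2 fun a ha => Subtype.ext ?_
      exact Submodule.disjoint_def.1 h.isCompl.disjoint a.1 ha.1 ha.2
    · refine eq_top_iff.2 fun a _ => ?_
      obtain ⟨y, hy, w, hw, hyw⟩ := Submodule.mem_sup.1 ((h.mem_subalgebra_iff hW).1 a.2)
      exact Submodule.mem_sup.2 ⟨⟨y, Submodule.mem_sup_left hy⟩, hy,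
        ⟨w, Submodule.mem_sup_right hw⟩, hW hw, Subtype.ext hyw⟩
  eq_bot n := by
    refine eq_bot_iff.2 fun a ha => Subtype.ext ?_
    have : (a : A) ∈ 𝒜 (n + 2) := ha
    rwa [h.eq_bot, Submodule.mem_bot] at this

theorem isUniversallyKoszul_subalgebra (h : IsConnectedTruncated 𝒜) {W : Submodule k A}
    (hW : W ≤ 𝒜 1) [FiniteDimensional k W] :
    IsUniversallyKoszul (inducedGrading 𝒜 (h.subalgebra W hW)) := by
  refine (h.inducedGrading_subalgebra hW).isUniversallyKoszul ?_
  let f : inducedGrading 𝒜 (h.subalgebra W hW) 1 →ₗ[k] W :=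
    LinearMap.codRestrict W
      ((h.subalgebra W hW).val.toLinearMap ∘ₗ (inducedGrading 𝒜 (h.subalgebra W hW) 1).subtype)
      (fun a => h.mem_of_mem_subalgebra hW a.1.2 a.2)
  refine FiniteDimensional.of_injective f fun a b hab => Subtype.ext (Subtype.ext ?_)
  exact congrArg (fun w : W => (w : A)) hab

end IsConnectedTruncated

/-- Injectivity passes to the directed colimit from the inclusions `S i → A`; surjectivity is the
covering hypothesis. -/
theorem directLimitToAlgebra_bijective {A : Type*} [Ring A] [Algebra k A] {ι : Type*} [Preorder ι]
    [DecidableEq ι] [IsDirectedOrder ι] (S : ι → Subalgebra k A) (hS : Monotone S)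
    (h : ∀ a, ∃ i, a ∈ S i) : Function.Bijective (directLimitToAlgebra S hS) := by
  refine ⟨Module.DirectLimit.lift_injective _ _ fun i => Subtype.val_injective, fun a => ?_⟩
  obtain ⟨i, hi⟩ := h a
  exact ⟨Module.DirectLimit.of k ι (fun i => S i) _ i ⟨a, hi⟩, Module.DirectLimit.lift_of _ _ _⟩

open Classical in
theorem IsConnectedGenDegOne.isAsymptoticallyUniversallyKoszul {A : Type v} [Ring A] [Algebra k A]
    {𝒜 : ℕ → Submodule k A} (hA : IsConnectedGenDegOne 𝒜) {ι : Type v} [Preorder ι]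
    [IsDirectedOrder ι] [Nonempty ι] (S : ι → Subalgebra k A) (hS : Monotone S)
    (hgr : ∀ i, IsGradedSubalgebra 𝒜 (S i))
    (hUK : ∀ i, IsUniversallyKoszul (inducedGrading 𝒜 (S i))) (hex : ∀ a, ∃ i, a ∈ S i)
    (hfin : ∀ W : Submodule k A, W ≤ 𝒜 1 → FiniteDimensional k W →
      ∃ i, W ≤ Subalgebra.toSubmodule (S i) ⊓ 𝒜 1) :
    IsAsymptoticallyUniversallyKoszul 𝒜 :=
  ⟨hA, ι, inferInstance, inferInstance, inferInstance, S, hS, hgr, hUK,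
    directLimitToAlgebra_bijective S hS hex, hfin⟩

/-- The filtered system is `k ⊕ W`, indexed by the finite-dimensional `W ≤ 𝒜 1` under inclusion;
sums of subspaces make it directed, and lines already cover `𝒜 1`. -/
theorem IsConnectedTruncated.isAsymptoticallyUniversallyKoszul {A : Type v} [Ring A] [Algebra k A]
    {𝒜 : ℕ → Submodule k A} (h : IsConnectedTruncated 𝒜) :
    IsAsymptoticallyUniversallyKoszul 𝒜 := by
  have hdir : IsDirectedOrder {W : Submodule k A // W ≤ 𝒜 1 ∧ FiniteDimensional k W} :=
    ⟨fun V W => by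
      have := V.2.2
      have := W.2.2
      exact ⟨⟨V.1 ⊔ W.1, sup_le V.2.1 W.2.1, inferInstance⟩,
        le_sup_left (a := V.1), le_sup_right (a := V.1)⟩⟩
  have hne : Nonempty {W : Submodule k A // W ≤ 𝒜 1 ∧ FiniteDimensional k W} :=
    ⟨⟨⊥, bot_le, inferInstance⟩⟩
  refine h.isConnectedGenDegOne.isAsymptoticallyUniversallyKoszul
    (fun W : {W : Submodule k A // W ≤ 𝒜 1 ∧ FiniteDimensional k W} => h.subalgebra W.1 W.2.1)
    (fun V W hVW => sup_le_sup_left (a := V.1) hVW (𝒜 0))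
    (fun W => h.isGradedSubalgebra W.2.1) (fun W => ?_) (fun a => ?_) (fun W hW hfin => ?_)
  · have := W.2.2
    exact h.isUniversallyKoszul_subalgebra W.2.1
  · obtain ⟨c, v, hv, rfl⟩ := h.exists_eq_add a
    exact ⟨⟨Submodule.span k {v}, by simpa using hv, inferInstance⟩,
      add_mem (Subalgebra.algebraMap_mem _ c)
        (Submodule.mem_sup_right (Submodule.mem_span_singleton_self v))⟩
  · exact ⟨⟨W, hW, hfin⟩, le_inf (le_sup_right (a := 𝒜 0)) hW⟩

end Truncated

/-! ### Difference equations on a free pro-`p` group -/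

section FreeProP

/-- A tube lemma: local constancy in `x` is uniform over the compact factor. It lets continuous
functions descend to finite quotients. -/
theorem eventually_forall_eq_of_discrete {X Y Z : Type*} [TopologicalSpace X] [TopologicalSpace Y]
    [CompactSpace Y] [TopologicalSpace Z] [DiscreteTopology Z] {f : X × Y → Z} (hf : Continuous f)
    (x₀ : X) : ∀ᶠ x in 𝓝 x₀, ∀ y, f (x, y) = f (x₀, y) := by
  have h := (isCompact_univ (X := Y)).eventually_forall_of_forall_eventually (x₀ := x₀)
    (P := fun x y => f (x, y) = f (x₀, y)) fun y _ => by
      have h : IsOpen {z : X × Y | f (z.1, z.2) = f (x₀, z.2)} :=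
        (isOpen_discrete {q : Z × Z | q.1 = q.2}).preimage
          (by fun_prop : Continuous fun z : X × Y => (f (z.1, z.2), f (x₀, z.2)))
      exact h.mem_nhds rfl
  simpa using h

theorem isProP_of_card {p : ℕ} {P : Type*} [Group P] [TopologicalSpace P]
    [DiscreteTopology P] [Finite P] {n : ℕ} (hp : p.Prime) (h : Nat.card P = p ^ n) : IsProP p P where
  isTopologicalGroup := inferInstance
  compactSpace := inferInstance
  t2Space := inferInstance
  totallyDisconnectedSpace := inferInstance
  index_eq N _ _ := by
    obtain ⟨m, -, hm⟩ := (Nat.dvd_prime_pow hp).1 (h ▸ N.index_dvd_card)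
    exact ⟨m, hm⟩

/-- The translation action of a group `Q` on the additive group of functions `Q → k`. -/
def translationAction (k Q : Type*) [AddCommGroup k] [Group Q] :
    Q →* MulAut (Multiplicative (Q → k)) where
  toFun q := AddEquiv.toMultiplicative
    { toFun := fun m r => m (r * q)
      invFun := fun m r => m (r * q⁻¹)
      left_inv := fun m => by simp
      right_inv := fun m => by simp
      map_add' := fun _ _ => rfl }
  map_one' := by
    refine MulEquiv.ext fun m => Multiplicative.toAdd.injective (funext fun r => ?_)
    exact congrArg m.toAdd (mul_one r)
  map_mul' q q' := by
    refine MulEquiv.ext fun m => Multiplicative.toAdd.injective (funext fun r => ?_)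
    exact congrArg m.toAdd (mul_assoc r q q').symm

theorem translationAction_apply {k Q : Type*} [AddCommGroup k] [Group Q] (q : Q)
    (m : Multiplicative (Q → k)) (r : Q) :
    (translationAction k Q q m).toAdd r = m.toAdd (r * q) := rfl

instance {k Q : Type*} [AddCommGroup k] [Group Q] :
    TopologicalSpace (Multiplicative (Q → k) ⋊[translationAction k Q] Q) := ⊥

instance {k Q : Type*} [AddCommGroup k] [Group Q] :
    DiscreteTopology (Multiplicative (Q → k) ⋊[translationAction k Q] Q) := ⟨rfl⟩

instance {k Q : Type*} [AddCommGroup k] [Group Q] [Finite k] [Finite Q] :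
    Finite (Multiplicative (Q → k) ⋊[translationAction k Q] Q) :=
  have : Finite (Multiplicative (Q → k)) := inferInstanceAs (Finite (Q → k))
  Finite.of_equiv _ SemidirectProduct.equivProd.symm

/-- The order is `p ^ (p ^ n) * p ^ n`. These groups are the test objects for the universal
property, since homomorphisms into them encode crossed homomorphisms with values in `Q → ZMod p`. -/
theorem isProP_translation (p : ℕ) [Fact p.Prime] {Q : Type*} [Group Q] [Finite Q] {n : ℕ}
    (hQ : Nat.card Q = p ^ n) :
    IsProP p (Multiplicative (Q → ZMod p) ⋊[translationAction (ZMod p) Q] Q) := by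
  refine isProP_of_card (n := p ^ n + n) Fact.out ?_
  have : Nat.card (Multiplicative (Q → ZMod p)) = p ^ (p ^ n) :=
    (Nat.card_fun (α := Q) (β := ZMod p)).trans (by rw [hQ, Nat.card_zmod])
  rw [SemidirectProduct.card, this, hQ, pow_add]

/-- The homomorphism to the semidirect product given by a homomorphism `π : F → Q` and a crossed
homomorphism `D : F → (Q → k)`. -/
def crossedHom {k Q F : Type*} [AddCommGroup k] [Group Q] [Group F] (π : F →* Q) (D : F → Q → k)
    (hD : ∀ g g' r, D (g * g') r = D g r + D g' (r * π g)) :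
    F →* Multiplicative (Q → k) ⋊[translationAction k Q] Q :=
  MonoidHom.mk' (fun g => ⟨Multiplicative.ofAdd (D g), π g⟩) fun g g' =>
    SemidirectProduct.ext
      (Multiplicative.toAdd.injective (funext fun r => hD g g' r)) (map_mul π g g')

variable {p : ℕ} {F : Type u} [Group F] [TopologicalSpace F]

theorem IsProP.exists_openNormalSubgroup (hF : IsProP p F) {s : Set F} (hs : s ∈ 𝓝 1) :
    ∃ U : OpenNormalSubgroup F, (U : Set F) ⊆ s := by
  have := hF.isTopologicalGroup
  have := hF.compactSpace
  have := hF.totallyDisconnectedSpace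
  obtain ⟨W, hWs, hW, h1⟩ := mem_nhds_iff.1 hs
  obtain ⟨U, hU⟩ := ProfiniteGrp.exist_openNormalSubgroup_sub_open_nhds_of_one hW h1
  exact ⟨U, hU.trans hWs⟩

theorem IsProP.card_quotient (hF : IsProP p F) (U : OpenNormalSubgroup F) :
    ∃ n, Nat.card (F ⧸ U.toSubgroup) = p ^ n :=
  hF.index_eq U.toSubgroup inferInstance U.isOpen'

variable [Fact p.Prime] {X : Type u} {b : X → F}

/-- Uniqueness half: the principal crossed homomorphism `g ↦ (r ↦ f (r g) - f r)` vanishes on the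
basis, hence everywhere. -/
theorem IsFreeProPOn.eq_of_invariant (h : IsFreeProPOn p b) (f : C(F, ZMod p))
    (hf : ∀ x g, f (g * b x) = f g) (g : F) : f g = f 1 := by
  have := h.isProP.isTopologicalGroup
  have := h.isProP.compactSpace
  -- `U` is small enough that `f` is invariant under right translation by `U` and so factors through
  -- `F ⧸ U`.
  obtain ⟨U, hU⟩ := h.isProP.exists_openNormalSubgroup
    (eventually_forall_eq_of_discrete (f := fun q : F × F => f (q.2 * q.1)) (by fun_prop) 1)
  have hU' : ∀ u ∈ U.toSubgroup, ∀ g, f (g * u) = f g := fun u hu g => by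
    simpa using hU hu g
  let Q := F ⧸ U.toSubgroup
  obtain ⟨n, hn⟩ := h.isProP.card_quotient U
  have : Finite Q := Nat.finite_of_card_ne_zero (hn ▸ pow_ne_zero n (Fact.out : p.Prime).ne_zero)
  have hfQ : ∀ a a' : F, QuotientGroup.leftRel U.toSubgroup a a' → f a = f a' := fun a a' h => by
    have := hU' _ (QuotientGroup.leftRel_apply.1 h) a
    rwa [mul_inv_cancel_left, eq_comm] at this
  let fQ : Q → ZMod p := Quotient.lift f hfQ
  let π : F →* Q := QuotientGroup.mk' U.toSubgroup
  have hπ : Continuous π := QuotientGroup.continuous_mk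
  let φ : F →ₜ* Multiplicative (Q → ZMod p) ⋊[translationAction (ZMod p) Q] Q :=
    { crossedHom π (fun g r => fQ (r * π g) - fQ r) (fun g g' r => by
        rw [map_mul, mul_assoc]; abel) with
      continuous_toFun := by
        change Continuous ((fun q : Q =>
          (⟨Multiplicative.ofAdd fun r => fQ (r * q) - fQ r, q⟩ :
            Multiplicative (Q → ZMod p) ⋊[translationAction (ZMod p) Q] Q)) ∘ π)
        exact continuous_of_discreteTopology.comp hπ }
  let ψ : F →ₜ* Multiplicative (Q → ZMod p) ⋊[translationAction (ZMod p) Q] Q :=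
    { SemidirectProduct.inr.comp π with
      continuous_toFun := (continuous_of_discreteTopology (f := SemidirectProduct.inr)).comp hπ }
  have hconv : ConvergesToOne fun x => ψ (b x) := by
    have h1 := ψ.continuous_toFun.tendsto 1
    change Filter.Tendsto ψ _ (𝓝 (ψ 1)) at h1
    rw [map_one] at h1
    exact h1.comp h.convergesToOne
  have hφψ : φ = ψ := by
    refine (h.existsUnique_lift _ (isProP_translation p hn) _ hconv).unique (fun x => ?_) fun _ => rfl
    refine SemidirectProduct.ext (Multiplicative.toAdd.injective (funext fun r => ?_)) rfl
    induction r using QuotientGroup.induction_on with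
    | H r =>
      change f (r * b x) - f r = 0
      rw [hf, sub_self]
  -- The first components of `φ` and `ψ` at `g`, evaluated at the identity coset, are `f g - f 1`
  -- and `0`.
  have h2 := congrArg (fun φ : F →ₜ* _ => (φ g).left.toAdd (1 : F)) hφψ
  change f (1 * g) - f 1 = 0 at h2
  rwa [one_mul, sub_eq_zero] at h2

/-- Existence half: the values `r ↦ c (r, b x) - c (r, 1)` prescribed on the basis extend to a
crossed homomorphism `D`. Evaluating `D (g g') r = D g r + D g' (r π(g))` at `r = 1`, `g' = b x`
gives the equation for `f g = D g 1`. -/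
theorem IsFreeProPOn.exists_primitive (h : IsFreeProPOn p b) (c : C(F × F, ZMod p)) :
    ∃ f : C(F, ZMod p), f 1 = 0 ∧
      ∀ x g, f (g * b x) = f g + (c (g, b x) - c (g, 1)) := by
  have := h.isProP.isTopologicalGroup
  have := h.isProP.compactSpace
  -- Two conditions on `U`: invariance of `c` in its first variable makes the prescribed values
  -- functions on `F ⧸ U`; `c (g, u) = c (g, 1)` for `u ∈ U` makes them trivial for the cofinitely
  -- many `b x` in `U`, so that the family converges to `1`.
  obtain ⟨U, hU⟩ := h.isProP.exists_openNormalSubgroup (Filter.inter_mem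
    (eventually_forall_eq_of_discrete
      (f := fun q : F × (F × F) => c (q.2.1 * q.1, q.2.2)) (by fun_prop) 1)
    (eventually_forall_eq_of_discrete (f := fun q : F × F => c (q.2, q.1)) (by fun_prop) 1))
  have hU1 : ∀ u ∈ U.toSubgroup, ∀ g y, c (g * u, y) = c (g, y) := fun u hu g y => by
    simpa using (hU hu).1 (g, y)
  have hU2 : ∀ u ∈ U.toSubgroup, ∀ g, c (g, u) = c (g, 1) := fun u hu => (hU hu).2
  let Q := F ⧸ U.toSubgroup
  obtain ⟨n, hn⟩ := h.isProP.card_quotient U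
  have : Finite Q := Nat.finite_of_card_ne_zero (hn ▸ pow_ne_zero n (Fact.out : p.Prime).ne_zero)
  have hcQ : ∀ y, ∀ a a' : F, QuotientGroup.leftRel U.toSubgroup a a' →
      c (a, y) - c (a, 1) = c (a', y) - c (a', 1) := fun y a a' h => by
    have := hU1 _ (QuotientGroup.leftRel_apply.1 h) a
    rw [mul_inv_cancel_left] at this
    rw [this, this]
  let cQ : F → Q → ZMod p := fun y => Quotient.lift (fun a => c (a, y) - c (a, 1)) (hcQ y)
  let π : F →* Q := QuotientGroup.mk' U.toSubgroup
  have hπ : Continuous π := QuotientGroup.continuous_mk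
  have hconv : ConvergesToOne fun x =>
      (⟨Multiplicative.ofAdd (cQ (b x)), π (b x)⟩ :
        Multiplicative (Q → ZMod p) ⋊[translationAction (ZMod p) Q] Q) := by
    have h1 : ∀ᶠ x in Filter.cofinite, b x ∈ U.toSubgroup :=
      h.convergesToOne (U.toOpenSubgroup.mem_nhds_one)
    refine tendsto_nhds_of_eventually_eq ?_
    filter_upwards [h1] with x hx
    refine SemidirectProduct.ext (Multiplicative.toAdd.injective (funext fun r => ?_))
      ((QuotientGroup.eq_one_iff _).2 hx)
    induction r using QuotientGroup.induction_on with
    | H r =>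
      change c (r, b x) - c (r, 1) = 0
      rw [hU2 _ hx, sub_self]
  obtain ⟨φ, hφ, -⟩ := h.existsUnique_lift _ (isProP_translation p hn) _ hconv
  -- The second component agrees with `π` on the basis, so uniqueness of lifts to `Q` identifies the
  -- two.
  have hright : ∀ g, (φ g).right = π g := by
    have hQ : IsProP p Q := isProP_of_card Fact.out hn
    let φ₁ : F →ₜ* Q :=
      { SemidirectProduct.rightHom.comp φ.toMonoidHom with
        continuous_toFun := (continuous_of_discreteTopology (f := SemidirectProduct.right)).comp
          φ.continuous_toFun }
    let φ₂ : F →ₜ* Q := { π with continuous_toFun := hπ }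
    have hconv' : ConvergesToOne fun x => φ₂ (b x) := by
      have h1 := hπ.tendsto 1
      rw [map_one] at h1
      exact h1.comp h.convergesToOne
    have h12 : φ₁ = φ₂ := by
      refine (h.existsUnique_lift _ hQ _ hconv').unique (fun x => ?_) fun _ => rfl
      exact congrArg SemidirectProduct.right (hφ x)
    exact fun g => DFunLike.congr_fun h12 g
  refine ⟨⟨fun g => (φ g).left.toAdd (1 : F), ?_⟩, ?_, fun x g => ?_⟩
  · exact (continuous_of_discreteTopology (f := fun q :
      Multiplicative (Q → ZMod p) ⋊[translationAction (ZMod p) Q] Q =>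
        q.left.toAdd (1 : F))).comp φ.continuous_toFun
  · change (φ 1).left.toAdd (1 : F) = 0
    rw [map_one]
    rfl
  · change (φ (g * b x)).left.toAdd (1 : F) = (φ g).left.toAdd (1 : F) + _
    rw [map_mul, SemidirectProduct.mul_left, toAdd_mul, Pi.add_apply, translationAction_apply,
      hright, hφ]
    congr 1
    change c (1 * g, b x) - c (1 * g, 1) = _
    rw [one_mul]

end FreeProP

/-! ### Vanishing of continuous cohomology in degrees at least two -/

namespace ContCoh

section Faces

variable {k : Type*} [CommRing k] {G : Type*} [Group G]

/-- The inhomogeneous differential without its last term. -/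
def partialD {n : ℕ} (F : (Fin n → G) → k) (s : Fin (n + 1) → G) : k :=
  F (fun i => s i.succ) +
    ∑ j : Fin n, (-1) ^ ((j : ℕ) + 1) * F (Fin.contractNth j.castSucc (· * ·) s)

theorem partialD_sub {n : ℕ} (F F' : (Fin n → G) → k) (s : Fin (n + 1) → G) :
    partialD (fun t => F t - F' t) s = partialD F s - partialD F' s := by
  simp only [partialD, mul_sub, Finset.sum_sub_distrib]
  ring

theorem partialD_mul_left {n : ℕ} (r : k) (F : (Fin n → G) → k) (s : Fin (n + 1) → G) :
    partialD (fun t => r * F t) s = r * partialD F s := by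
  simp only [partialD, mul_add, Finset.mul_sum, mul_left_comm]

theorem partialD_zero {n : ℕ} (s : Fin (n + 1) → G) :
    partialD (fun _ : Fin n → G => (0 : k)) s = 0 := by
  simp [partialD]

theorem contractNth_snoc {n : ℕ} (j : Fin n) (s : Fin (n + 1) → G) (y : G) :
    Fin.contractNth j.castSucc.castSucc (· * ·) (Fin.snoc s y : Fin (n + 2) → G) =
      (Fin.snoc (Fin.contractNth j.castSucc (· * ·) s) y : Fin (n + 1) → G) := by
  funext i
  refine Fin.lastCases ?_ (fun i => ?_) i
  · simp only [Fin.contractNth, Fin.snoc_last]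
    rw [if_neg (by simp), if_neg (by simp; omega)]
    exact Fin.snoc_last (α := fun _ => G) y s
  · simp only [Fin.contractNth, Fin.snoc_castSucc, Fin.val_castSucc, Fin.succ_castSucc]

theorem contractNth_castSucc_last_snoc {n : ℕ} (s : Fin (n + 1) → G) (y : G) :
    Fin.contractNth (Fin.last n).castSucc (· * ·) (Fin.snoc s y : Fin (n + 2) → G) =
      (Fin.snoc (Fin.init s) (s (Fin.last n) * y) : Fin (n + 1) → G) := by
  funext i
  refine Fin.lastCases ?_ (fun i => ?_) i
  · simp [Fin.contractNth]
  · simp [Fin.contractNth, Fin.init]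

theorem contractNth_last {n : ℕ} (s : Fin (n + 1) → G) :
    Fin.contractNth (Fin.last n) (· * ·) s = Fin.init s := by
  funext i
  simp [Fin.contractNth, Fin.init]

/-- Splits off the last variable `y`: it is a mere parameter in every face except the one that
multiplies it into its neighbour. -/
theorem partialD_snoc {n : ℕ} (F : (Fin (n + 1) → G) → k) (s : Fin (n + 1) → G) (y : G) :
    partialD F (Fin.snoc s y) = partialD (fun t => F (Fin.snoc t y)) s +
      (-1) ^ (n + 1) * F (Fin.snoc (Fin.init s) (s (Fin.last n) * y)) := by
  have h : (fun i : Fin (n + 1) => (Fin.snoc s y : Fin (n + 2) → G) i.succ) =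
      Fin.snoc (fun i : Fin n => s i.succ) y := by
    funext i
    refine Fin.lastCases ?_ (fun i => ?_) i
    · simp
    · rw [Fin.succ_castSucc]
      simp only [Fin.snoc_castSucc]
  rw [partialD, partialD, Fin.sum_univ_castSucc, contractNth_castSucc_last_snoc, h]
  simp only [contractNth_snoc, Fin.val_castSucc, Fin.val_last]
  ring

end Faces

section

variable {k : Type*} [CommRing k] [TopologicalSpace k] [IsTopologicalRing k]
  {G : Type*} [Group G] [TopologicalSpace G] [IsTopologicalGroup G]

theorem d_eq_partialD {n : ℕ} (f : Cochain k G n) (s : Fin (n + 1) → G) :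
    d k G n f s = partialD f s + (-1) ^ (n + 1) * f (Fin.init s) := by
  rw [d_apply, Fin.sum_univ_castSucc, contractNth_last, partialD, add_assoc]
  rfl

theorem d_snoc {n : ℕ} (f : Cochain k G n) (s : Fin n → G) (y : G) :
    d k G n f (Fin.snoc s y : Fin (n + 1) → G) = partialD f (Fin.snoc s y) + (-1) ^ (n + 1) * f s := by
  rw [d_eq_partialD, Fin.init_snoc]

/-- If the discrete equation `f (g x) - f g = h g x - h g 1`, where `x` runs through a set `X`
such that only constant functions are invariant under `X`, is always solvable, then continuous
cohomology vanishes in degrees at least two. -/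
theorem cocycles_le_coboundaries [DiscreteTopology k] [CompactSpace G] {X : Set G}
    (hconst : ∀ f : C(G, k), (∀ x ∈ X, ∀ g, f (g * x) = f g) → ∀ g, f g = f 1)
    (hsolve : ∀ h : C(G × G, k), ∃ f : C(G, k), f 1 = 0 ∧
      ∀ x ∈ X, ∀ g, f (g * x) = f g + (h (g, x) - h (g, 1))) (n : ℕ) :
    cocycles k G (n + 2) ≤ coboundaries k G (n + 2) := by
  intro c hc
  have hc0 : d k G (n + 2) c = 0 := hc
  -- The cocycle identity at `(s, y, x)`, with the faces involving the last variables written out.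
  have hcz : ∀ (s : Fin (n + 1) → G) (y x : G),
      partialD (fun t => c (Fin.snoc (Fin.snoc t y : Fin (n + 1) → G) x)) s +
        (-1) ^ (n + 1) * c (Fin.snoc (Fin.snoc (Fin.init s) (s (Fin.last n) * y) : Fin (n + 1) → G) x)
        + (-1) ^ (n + 2) * c (Fin.snoc s (y * x)) - (-1) ^ (n + 2) * c (Fin.snoc s y) = 0 := by
    intro s y x
    have h := DFunLike.congr_fun hc0
      (Fin.snoc (Fin.snoc s y : Fin (n + 2) → G) x : Fin (n + 3) → G)
    rw [d_snoc, partialD_snoc, partialD_snoc, Fin.init_snoc, Fin.snoc_last] at h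
    rw [← (show _ = (0 : k) from h)]
    ring
  choose sol sol_one sol_mul using hsolve
  -- The first `n` arguments of `c` are parameters, and the difference equation is solved in the
  -- last two. The sign `(-1) ^ (n + 1)` is that of the face of `d b` merging its last two
  -- arguments.
  let H : C(Fin n → G, C(G × G, k)) := ContinuousMap.curry
    ⟨fun q => (-1) ^ (n + 1) * c (Fin.snoc (Fin.snoc q.1 q.2.1 : Fin (n + 1) → G) q.2.2),
      by fun_prop⟩
  have hH : ∀ t g x, H t (g, x) =
      (-1) ^ (n + 1) * c (Fin.snoc (Fin.snoc t g : Fin (n + 1) → G) x) := fun _ _ _ => rfl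
  let b : Cochain k G (n + 1) :=
    ⟨fun s => sol (H (Fin.init s)) (s (Fin.last n)), by
      -- The solutions are chosen with no continuity in the parameter; since `H` is locally
      -- constant, the choice is locally constant too.
      refine continuous_iff_continuousAt.2 fun s => ?_
      have h1 : ∀ᶠ t in 𝓝 s, H (Fin.init t) = H (Fin.init s) := by
        filter_upwards [eventually_forall_eq_of_discrete
          (f := fun q : (Fin (n + 1) → G) × (G × G) => H (Fin.init q.1) q.2)
          (by change Continuous fun q : (Fin (n + 1) → G) × (G × G) => (-1) ^ (n + 1) *
                c (Fin.snoc (Fin.snoc (Fin.init q.1) q.2.1 : Fin (n + 1) → G) q.2.2)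
              fun_prop) s] with t ht
        exact ContinuousMap.ext ht
      have h2 : ContinuousAt (fun t : Fin (n + 1) → G => sol (H (Fin.init s)) (t (Fin.last n))) s :=
        ((sol (H (Fin.init s))).continuous.comp (continuous_apply _)).continuousAt
      refine h2.congr ?_
      filter_upwards [h1] with t ht
      rw [ht]⟩
  have hb : ∀ t g, b (Fin.snoc t g : Fin (n + 1) → G) = sol (H t) g := fun t g => by
    change sol (H (Fin.init (Fin.snoc t g : Fin (n + 1) → G)))
      ((Fin.snoc t g : Fin (n + 1) → G) (Fin.last n)) = _
    rw [Fin.init_snoc, Fin.snoc_last]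
  have hb1 : ∀ t, b (Fin.snoc t 1 : Fin (n + 1) → G) = 0 := fun t => by rw [hb, sol_one]
  have hbm : ∀ t g, ∀ x ∈ X, b (Fin.snoc t (g * x) : Fin (n + 1) → G) - b (Fin.snoc t g) =
      (-1) ^ (n + 1) * (c (Fin.snoc (Fin.snoc t g : Fin (n + 1) → G) x) -
        c (Fin.snoc (Fin.snoc t g : Fin (n + 1) → G) 1)) := fun t g x hx => by
    rw [hb, hb, sol_mul _ x hx, hH, hH]
    ring
  have hdb : ∀ (s : Fin (n + 1) → G) y, d k G (n + 1) b (Fin.snoc s y) =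
      partialD (fun t => b (Fin.snoc t y)) s +
        (-1) ^ (n + 1) * b (Fin.snoc (Fin.init s) (s (Fin.last n) * y)) + (-1) ^ (n + 2) * b s :=
    fun s y => by rw [d_snoc, partialD_snoc]
  -- `d b - c` does not depend on its last argument
  have hinv : ∀ (s : Fin (n + 1) → G) (y : G), d k G (n + 1) b (Fin.snoc s y) - c (Fin.snoc s y) =
      d k G (n + 1) b (Fin.snoc s 1) - c (Fin.snoc s 1) := by
    intro s
    refine hconst ⟨fun y => d k G (n + 1) b (Fin.snoc s y) - c (Fin.snoc s y), by fun_prop⟩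
      fun x hx y => ?_
    change d k G (n + 1) b (Fin.snoc s (y * x)) - c (Fin.snoc s (y * x)) =
      d k G (n + 1) b (Fin.snoc s y) - c (Fin.snoc s y)
    -- Replacing `y` by `y * x` changes `d b` by differences of values of `c` at last arguments `x`
    -- and `1`. Subtracting the cocycle identities at `(s, y, x)` and `(s, y, 1)` turns these into
    -- `c (s, y x) - c (s, y)`.
    have h1 := hcz s y x
    have h2 := hcz s y 1
    have h3 : partialD (fun t => b (Fin.snoc t (y * x))) s - partialD (fun t => b (Fin.snoc t y)) s =
        (-1) ^ (n + 1) * (partialD (fun t => c (Fin.snoc (Fin.snoc t y : Fin (n + 1) → G) x)) s -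
          partialD (fun t => c (Fin.snoc (Fin.snoc t y : Fin (n + 1) → G) 1)) s) := by
      rw [← partialD_sub, ← partialD_sub, ← partialD_mul_left]
      exact congrArg (fun F => partialD F s) (funext fun t => hbm t y x hx)
    have h4 := hbm (Fin.init s) (s (Fin.last n) * y) x hx
    have h5 : ((-1 : k) ^ (n + 1)) ^ 2 = 1 := by rw [← pow_mul, mul_comm, pow_mul]; simp
    rw [hdb, hdb, ← mul_assoc]
    rw [mul_one] at h2
    rw [pow_succ (-1 : k) (n + 1)] at h1 h2
    linear_combination h3 + (-1) ^ (n + 1) * h4 + (-1) ^ (n + 1) * (h1 - h2) +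
      (c (Fin.snoc s (y * x)) - c (Fin.snoc s y)) * h5
  -- By `hinv` and `b (t, 1) = 0`, the defect is `d b (s, y) - c (s, y) = -c (s, 1)`. The cochain
  -- `b₀ (t, g) = c (t, 1, 1)` ignores `g`, so the last two faces of `d b₀` cancel; the cocycle
  -- identity at `(s, 1, 1)` then gives `d b₀ (s, y) = (-1) ^ n c (s, 1)`.
  let b₀ : Cochain k G (n + 1) :=
    ⟨fun s => c (Fin.snoc (Fin.snoc (Fin.init s) 1 : Fin (n + 1) → G) 1), by fun_prop⟩
  have hb₀ : ∀ (s : Fin (n + 1) → G) y, d k G (n + 1) b₀ (Fin.snoc s y) =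
      partialD (fun t => c (Fin.snoc (Fin.snoc t 1 : Fin (n + 1) → G) 1)) s := fun s y => by
    have h : ∀ t g, b₀ (Fin.snoc t g : Fin (n + 1) → G) =
        c (Fin.snoc (Fin.snoc t 1 : Fin (n + 1) → G) 1) := fun t g => by
      change c (Fin.snoc (Fin.snoc (Fin.init (Fin.snoc t g : Fin (n + 1) → G)) 1 :
        Fin (n + 1) → G) 1) = _
      rw [Fin.init_snoc]
    have h' : b₀ s = c (Fin.snoc (Fin.snoc (Fin.init s) 1 : Fin (n + 1) → G) 1) := rfl
    rw [d_snoc, partialD_snoc, h', h]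
    simp only [h]
    ring
  refine ⟨b + (-1 : k) ^ n • b₀, ?_⟩
  ext z
  obtain ⟨s, y, rfl⟩ : ∃ (s : Fin (n + 1) → G) (y : G), z = Fin.snoc s y :=
    ⟨Fin.init z, z (Fin.last _), (Fin.snoc_init_self z).symm⟩
  have h1 := hinv s y
  have h2 : d k G (n + 1) b (Fin.snoc s 1) = 0 := by
    rw [hdb]
    simp only [hb1, partialD_zero, mul_one, Fin.snoc_init_self]
    ring
  have h3 := hcz s 1 1
  rw [mul_one, mul_one, Fin.snoc_init_self] at h3
  rw [map_add, map_smul, ContinuousMap.add_apply, ContinuousMap.smul_apply, smul_eq_mul, hb₀]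
  have h5 : ((-1 : k) ^ n) ^ 2 = 1 := by rw [← pow_mul, mul_comm, pow_mul]; simp
  rw [pow_succ (-1 : k) n] at h3
  linear_combination h1 + h2 + (-1) ^ n * h3 + c (Fin.snoc s 1) * h5

end

end ContCoh

/-! ### The cohomology algebra of a free pro-`p` group -/

namespace ContCoh

section

variable (k : Type v) [Field k] [TopologicalSpace k] [IsTopologicalRing k]
  (G : Type u) [Group G] [TopologicalSpace G] [IsTopologicalGroup G]

theorem exists_eq_mk_constZ (a : H k G 0) : ∃ r : k, a = mk (constZ r) := by
  obtain ⟨z, rfl⟩ := exists_mk a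
  refine ⟨z.1 Fin.elim0, congrArg mk (Subtype.ext (ContinuousMap.ext fun x => ?_))⟩
  change z.1 x = z.1 _
  rw [Subsingleton.elim x]

theorem algebraMap_total (r : k) :
    algebraMap k (Total k G) r = DirectSum.lof k ℕ (H k G) 0 (mk (constZ r)) := rfl

/-- Degree zero consists of constants because a `0`-cochain is a function on a one-point space, and
these inject because there are no nonzero coboundaries in degree zero. The hypothesis kills all
degrees from two on. -/
theorem isConnectedTruncated_grading
    (h : ∀ n, cocycles k G (n + 2) ≤ coboundaries k G (n + 2)) :
    IsConnectedTruncated (grading k G) where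
  gradedMonoid :=
    { one_mem := ⟨mk (constZ 1), rfl⟩
      mul_mem := by
        rintro i j _ _ ⟨a, rfl⟩ ⟨b, rfl⟩
        exact ⟨GradedMonoid.GMul.mul a b, (DirectSum.of_mul_of a b).symm⟩ }
  injective_algebraMap := by
    refine (injective_iff_map_eq_zero _).2 fun r hr => ?_
    rw [algebraMap_total] at hr
    have h1 : mk (constZ (G := G) r) = 0 :=
      (DirectSum.of_injective (β := H k G) 0) (hr.trans (map_zero _).symm)
    have h2 : (constZ (G := G) r).1 = 0 := mk_eq_zero.1 h1
    exact DFunLike.congr_fun h2 Fin.elim0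
  degree_zero := by
    ext x
    constructor
    · rintro ⟨a, rfl⟩
      obtain ⟨r, rfl⟩ := exists_eq_mk_constZ k G a
      exact ⟨r, rfl⟩
    · rintro ⟨r, rfl⟩
      exact ⟨mk (constZ r), rfl⟩
  isCompl := by
    refine IsCompl.of_eq (eq_bot_iff.2 ?_) (eq_top_iff.2 fun x _ => ?_)
    · rintro _ ⟨⟨a, rfl⟩, b, hb⟩
      have h1 := DFunLike.congr_fun hb 0
      rw [DirectSum.lof_apply, DirectSum.lof_eq_of, DirectSum.of_eq_of_ne _ _ _ (by decide)] at h1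
      rw [← h1, map_zero]
      exact zero_mem _
    · induction x using DirectSum.induction_on with
      | zero => exact zero_mem _
      | of i a =>
        match i with
        | 0 => exact Submodule.mem_sup_left ⟨a, rfl⟩
        | 1 => exact Submodule.mem_sup_right ⟨a, rfl⟩
        | n + 2 =>
          obtain ⟨z, rfl⟩ := exists_mk a
          rw [mk_eq_zero.2 (h n z.2), map_zero]
          exact zero_mem _
      | add x y hx hy => exact add_mem (hx trivial) (hy trivial)
  eq_bot n := by
    refine eq_bot_iff.2 ?_
    rintro _ ⟨a, rfl⟩
    obtain ⟨z, rfl⟩ := exists_mk a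
    rw [mk_eq_zero.2 (h n z.2), map_zero]
    exact zero_mem _

end

/-- A free pro-`p` group has cohomological dimension at most one. -/
theorem cocycles_le_coboundaries_of_isFreeProP {p : ℕ} [Fact p.Prime] {F : Type u} [Group F]
    [TopologicalSpace F] [IsTopologicalGroup F] (hF : IsFreeProP p F) (n : ℕ) :
    cocycles (ZMod p) F (n + 2) ≤ coboundaries (ZMod p) F (n + 2) := by
  obtain ⟨X, b, hb⟩ := hF
  have := hb.isProP.compactSpace
  refine cocycles_le_coboundaries (X := Set.range b)
    (fun f hf => hb.eq_of_invariant f fun x => hf _ ⟨x, rfl⟩) (fun c => ?_) n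
  obtain ⟨f, hf1, hf⟩ := hb.exists_primitive c
  refine ⟨f, hf1, ?_⟩
  rintro _ ⟨x, rfl⟩ g
  exact hf x g

end ContCoh

theorem mainTheorem4 (p : ℕ) [Fact p.Prime] (K : Type u) [Field K]
    (hK : ContainsRootsOfUnity p K)
    (hG : IsFreeProP p (maximalProPGaloisGroup p K)) :
    HasAsymptoticallyUniversallyKoszulCohomology p K :=
  (ContCoh.isConnectedTruncated_grading (ZMod p) (maximalProPGaloisGroup p K)
    (ContCoh.cocycles_le_coboundaries_of_isFreeProP hG)).isAsymptoticallyUniversallyKoszul
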